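/- **Proposition (e-geodesics).** Let $c\in\mathbb{N}$, let $\mathcal{D}_c=\{\rho\in\mathbb{C}^{c\times c}:\rho=\rho^*,\ \rho\succ0,\ \operatorname{tr}\rho=1\}$ be the manifold of positive definite density matrices and $\mathcal{H}_{c,0}=\{X\in\mathbb{C}^{c\times c}: X=X^*,\ \operatorname{tr}X=0\}$ its tangent space at every point, so that $T\mathcal{D}_c=\mathcal{D}_c\times\mathcal{H}_{c,0}$. Equip $\mathcal{D}_c$ with the Bogoliubov–Kubo–Mori (BKM) metric $$g_\rho(X,Y)=\int_0^\infty \operatorname{tr}\big(X(\rho+\lambda I)^{-1}Y(\rho+\lambda I)^{-1}\big)\,d\lambda .$$ Let $\nabla^*$ be the m-connection, i.e. the flat connection $(\nabla^*_XY)(\rho)=\frac{d}{dt}Y(\rho+tX(\rho))\big|_{t=0}$ that $\mathcal{D}_c$ inherits from the affine space of Hermitian matrices of trace one, and let the e-connection be the affine connection $\nabla$ on $\mathcal{D}_c$ dual to $\nabla^*$ with respect to $g$, i.e. $X\,g(Y,Z)=g(\nabla_XY,Z)+g(Y,\nabla^*_XZ)$ for all smooth vector fields $X,Y,Z$ on $\mathcal{D}_c$.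 Put $$\Gamma(H)=\frac{\exp H}{\operatorname{tr}\exp H}\quad(\Gamma\colon\mathcal{H}_{c,0}\to\mathcal{D}_c,\text{ a bijection with inverse }\Gamma^{-1}),\qquad \Pi_{c,0}[X]=X-\tfrac{\operatorname{tr}X}{c}I,\qquad \mathbb{T}_\rho[X]=\tfrac{d}{dt}\log(\rho+tX)\big|_{t=0}.$$ The e-connection exists and is unique. For every $\rho\in\mathcal{D}_c$ and $X\in\mathcal{H}_{c,0}$, the curve $$\gamma(t)=\Gamma\big(\Gamma^{-1}(\rho)+t\,\Pi_{c,0}\mathbb{T}_\rho[X]\big),\qquad t\in\mathbb{R},$$ is a geodesic of the e-connection with $\gamma(0)=\rho$ and $\gamma'(0)=X$, and every geodesic of the e-connection on an interval containing $0$ with the same initial data agrees with $\gamma$ on that interval. Accordingly, the exponential map of the e-connection (the value at time $1$ of the geodesic with the given initial data) is defined on all of $\mathcal{H}_{c,0}$, satisfies $\gamma(t)=\operatorname{Exp}^{(e)}_\rho(tX)$ for all $t\in\mathbb{R}$, and is given by $$\operatorname{Exp}^{(e)}_\rho(X)=\Gamma\big(\Gamma^{-1}(\rho)+d\Gamma^{-1}(\rho)[X]\big)=\Gamma\big(\Gamma^{-1}(\rho)+\Pi_{c,0}\mathbb{T}_\rho[X]\big).$$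 -/

import Mathlib

open scoped ContDiff ComplexOrder Matrix.Norms.L2Operator

namespace QuantumStates

/-- Complex `c × c` matrices, regarded as a real normed space (the operator norm is only used for
its topology and differentiable structure, which do not depend on the choice of a norm). -/
abbrev Mat (c : ℕ) : Type := Matrix (Fin c) (Fin c) ℂ

/-- The manifold of density matrices: positive definite Hermitian matrices of trace one. -/
def densityMatrices (c : ℕ) : Set (Mat c) := {ρ | ρ.PosDef ∧ ρ.trace = 1}

/-- Traceless Hermitian matrices: the tangent space of `densityMatrices c` at every point. -/
def tracelessHermitian (c : ℕ) : Submodule ℝ (Mat c) where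
  carrier := {X | X.IsHermitian ∧ X.trace = 0}
  add_mem' := by
    rintro X Y ⟨hX, hX0⟩ ⟨hY, hY0⟩
    exact ⟨hX.add hY, by rw [Matrix.trace_add, hX0, hY0, add_zero]⟩
  zero_mem' := ⟨Matrix.isHermitian_zero, Matrix.trace_zero _ _⟩
  smul_mem' := by
    rintro a X ⟨hX, hX0⟩
    refine ⟨?_, by rw [Matrix.trace_smul, hX0, smul_zero]⟩
    change Matrix.conjTranspose (a • X) = a • X
    rw [Matrix.conjTranspose_smul, hX.eq, star_trivial]

noncomputable section

/-- The orthogonal projection of (Hermitian) matrices onto the traceless ones. -/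
def projTraceless {c : ℕ} (X : Mat c) : Mat c := X - (X.trace / (c : ℂ)) • (1 : Mat c)

/-- The matrix logarithm of a Hermitian positive definite matrix. -/
def logm {c : ℕ} (ρ : Mat c) : Mat c := CFC.log ρ

/-- `T_ρ[X] = d/dt log (ρ + t X)` at `t = 0`. -/
def opT {c : ℕ} (ρ X : Mat c) : Mat c := lineDeriv ℝ (logm (c := c)) ρ X

/-- `Γ(X) = exp X / tr (exp X)`. -/
def Gam {c : ℕ} (X : Mat c) : Mat c :=
  (NormedSpace.exp X).trace⁻¹ • NormedSpace.exp X

/-- The inverse of the bijection `Γ` from traceless Hermitian matrices to density matrices: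
`GamInv ρ` is the traceless Hermitian matrix `H` with `Γ(H) = ρ`. -/
def GamInv {c : ℕ} : Mat c → Mat c :=
  Function.invFunOn Gam (tracelessHermitian c : Set (Mat c))

/-- The differential of `Γ⁻¹` at `ρ` applied to the tangent vector `X`. -/
def dGamInv {c : ℕ} (ρ X : Mat c) : Mat c := lineDeriv ℝ GamInv ρ X

/-- The Bogoliubov-Kubo-Mori metric
`g_ρ(X, Y) = ∫₀^∞ tr (X (ρ + s I)⁻¹ Y (ρ + s I)⁻¹) ds`. For Hermitian `ρ`, `X`, `Y` the trace
is a real number. -/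
def bkm {c : ℕ} (ρ X Y : Mat c) : ℝ :=
  ∫ s in Set.Ioi (0 : ℝ),
    (X * (ρ + (s : ℂ) • (1 : Mat c))⁻¹ * Y * (ρ + (s : ℂ) • (1 : Mat c))⁻¹).trace.re

/-- Smooth vector fields on the manifold of density matrices, via the trivialization of its
tangent bundle as `densityMatrices c × tracelessHermitian c`. Only the values on
`densityMatrices c` are relevant. -/
def IsVectorField {c : ℕ} (Y : Mat c → Mat c) : Prop :=
  ContDiffOn ℝ ∞ Y (densityMatrices c) ∧
    ∀ ρ ∈ densityMatrices c, Y ρ ∈ tracelessHermitian c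

/-- Affine connections (covariant derivatives of vector fields) `(X, Y) ↦ ∇_X Y` on the manifold
of density matrices. -/
structure IsAffineConnection {c : ℕ}
    (nab : (Mat c → Mat c) → (Mat c → Mat c) → Mat c → Mat c) : Prop where
  isVectorField : ∀ {X Y}, IsVectorField X → IsVectorField Y → IsVectorField (nab X Y)
  add_left : ∀ {X X' Y}, IsVectorField X → IsVectorField X' → IsVectorField Y →
    ∀ ρ ∈ densityMatrices c,
      nab (fun σ => X σ + X' σ) Y ρ = nab X Y ρ + nab X' Y ρ
  smul_left : ∀ {X Y} {f : Mat c → ℝ}, IsVectorField X → IsVectorField Y →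
    ContDiffOn ℝ ∞ f (densityMatrices c) → ∀ ρ ∈ densityMatrices c,
      nab (fun σ => f σ • X σ) Y ρ = f ρ • nab X Y ρ
  add_right : ∀ {X Y Y'}, IsVectorField X → IsVectorField Y → IsVectorField Y' →
    ∀ ρ ∈ densityMatrices c,
      nab X (fun σ => Y σ + Y' σ) ρ = nab X Y ρ + nab X Y' ρ
  leibniz : ∀ {X Y} {f : Mat c → ℝ}, IsVectorField X → IsVectorField Y →
    ContDiffOn ℝ ∞ f (densityMatrices c) → ∀ ρ ∈ densityMatrices c,
      nab X (fun σ => f σ • Y σ) ρ = f ρ • nab X Y ρ + lineDeriv ℝ f ρ (X ρ) • Y ρ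

/-- The m-connection (mixture connection): the flat connection which the manifold of density
matrices inherits as an open subset of the affine space of Hermitian matrices of trace one, i.e.
`(∇*_X Y)(ρ) = d/dt Y(ρ + t X(ρ))` at `t = 0`. -/
def mConnection {c : ℕ} (X Y : Mat c → Mat c) (ρ : Mat c) : Mat c := lineDeriv ℝ Y ρ (X ρ)

/-- Duality of two connections with respect to the Bogoliubov-Kubo-Mori metric:
`X g(Y, Z) = g(∇_X Y, Z) + g(Y, ∇'_X Z)`. -/
def AreDual {c : ℕ} (nab nab' : (Mat c → Mat c) → (Mat c → Mat c) → Mat c → Mat c) : Prop :=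
  ∀ {X Y Z}, IsVectorField X → IsVectorField Y → IsVectorField Z → ∀ ρ ∈ densityMatrices c,
    lineDeriv ℝ (fun σ => bkm σ (Y σ) (Z σ)) ρ (X ρ) =
      bkm ρ (nab X Y ρ) (Z ρ) + bkm ρ (Y ρ) (nab' X Z ρ)

/-- The e-connection (exponential connection) of the Bogoliubov-Kubo-Mori geometry: the affine
connection dual to the m-connection with respect to the Bogoliubov-Kubo-Mori metric. -/
structure IsEConnection {c : ℕ}
    (nab : (Mat c → Mat c) → (Mat c → Mat c) → Mat c → Mat c) : Prop where
  isAffineConnection : IsAffineConnection nab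
  dual : AreDual nab mConnection

/-- `γ : J → densityMatrices c` is a geodesic of the connection `nab` on the interval `J` which
emanates at `ρ` in the direction `X`. Here `v` is the velocity, and the geodesic equation
`∇_{γ'} γ' = 0` is written in the global frame of constant vector fields, where the covariant
derivative of a vector field `V` along `γ` is `V'(t) + (∇_{γ'(t)} V(t))(γ(t))`, the second term
being taken with the constant vector fields of values `γ'(t)` and `V(t)`. -/
def IsGeodesicFrom {c : ℕ} (nab : (Mat c → Mat c) → (Mat c → Mat c) → Mat c → Mat c)
    (J : Set ℝ) (ρ X : Mat c) (γ : ℝ → Mat c) : Prop :=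
  ∃ v : ℝ → Mat c, γ 0 = ρ ∧ v 0 = X ∧ ∀ t ∈ J,
    γ t ∈ densityMatrices c ∧
    HasDerivWithinAt γ (v t) J t ∧
    HasDerivWithinAt v (-(nab (fun _ => v t) (fun _ => v t) (γ t))) J t

open Classical in
/-- The exponential map of a connection: the value at time `1` of the geodesic that emanates at
`ρ` in the direction `X` (and `0`, which is not a density matrix, if there is none). -/
def expMap {c : ℕ} (nab : (Mat c → Mat c) → (Mat c → Mat c) → Mat c → Mat c)
    (ρ X : Mat c) : Mat c :=
  if h : ∃ γ : ℝ → Mat c, IsGeodesicFrom nab (Set.Icc 0 1) ρ X γ then h.choose 1 else 0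

end

end QuantumStates

open QuantumStates

/-! ### Smooth dependence of an integral over [0, 1] on a parameter. -/

section ParametricIntegral

open Set Filter Topology

variable {E : Type} [NormedAddCommGroup E] [NormedSpace ℝ E]

/-! The BKM metric is the trace pairing with the differential of the logarithm: g_ρ(X, Y) = Re tr(X
· D log_ρ[Y]). Write θ = Π ∘ log (`eChart`), whose inverse is Γ. A traceless Z does not see the
scalar part removed by Π, so g(Y, Z) = Re tr(Z · dθ(Y)) (`bkm_eq_tracePairing_eChart`). The base
point now enters only through Z and dθ(Y). The product rule therefore splits X g(Y, Z) into a term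
with the flat derivative of Z, which is the m-connection, and a term with the flat derivative of
dθ(Y). So the dual connection is the flat connection pulled back by θ (`areDual_chartConnection`).
It is unique because the metric is nondegenerate (`IsEConnection.eqOn`). Its geodesics are straight
lines in the chart θ, and Γ maps them back to density matrices (`IsGeodesicFrom.eq_Gam`,
`isGeodesicFrom_Gam`).

The analytic input is the formula log M = ∫₀¹ (M - 1)(1 + t(M - 1))⁻¹ dt on matrices with positive
definite Hermitian part. These form an open set of matrices, so smoothness and the differential of
log follow by differentiating under the integral. The substitution s = 1/t - 1 turns that
differential into the integral defining the metric. -/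

theorem hasFDerivAt_parametric_intervalIntegral {G : Type} [NormedAddCommGroup G]
    [NormedSpace ℝ G] {F : E × ℝ → G} {W : Set (E × ℝ)} (hW : IsOpen W)
    (hF : ContDiffOn ℝ ∞ F W) {x₀ : E} (hx : ∀ t ∈ Icc (0 : ℝ) 1, (x₀, t) ∈ W) :
    HasFDerivAt (fun x => ∫ t in (0 : ℝ)..1, F (x, t))
      (∫ t in (0 : ℝ)..1, (fderiv ℝ F (x₀, t)).comp (ContinuousLinearMap.inl ℝ E ℝ)) x₀ := by
  set F' : E × ℝ → E →L[ℝ] G :=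
    fun p => (fderiv ℝ F p).comp (ContinuousLinearMap.inl ℝ E ℝ) with hF'def
  have hF' : ContinuousOn F' W :=
    (hF.continuousOn_fderiv_of_isOpen hW (by simp)).clm_comp continuousOn_const
  have hderiv : ∀ p ∈ W, HasFDerivAt (fun x => F (x, p.2)) (F' p) p.1 := fun p hp =>
    ((hF.differentiableOn (by simp)).differentiableAt (hW.mem_nhds hp)).hasFDerivAt.comp p.1
      (hasFDerivAt_prodMk_left p.1 p.2)
  have hline : ∀ x : E, (∀ t ∈ Icc (0 : ℝ) 1, (x, t) ∈ W) →
      ContinuousOn (fun t => F (x, t)) (Icc 0 1) ∧ ContinuousOn (fun t => F' (x, t)) (Icc 0 1) :=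
    fun x h => ⟨hF.continuousOn.comp (by fun_prop) h, hF'.comp (by fun_prop) h⟩
  obtain ⟨C, hC⟩ := isCompact_Icc.exists_bound_of_continuousOn (hline x₀ hx).2
  -- Compactness of [0, 1] makes both the domain condition and the bound on the derivative uniform
  -- in t, which supplies the dominating constant.
  have hnear : ∀ᶠ x in 𝓝 x₀, ∀ t ∈ Icc (0 : ℝ) 1, (x, t) ∈ W ∧ ‖F' (x, t)‖ ≤ C + 1 := by
    refine isCompact_Icc.eventually_forall_of_forall_eventually fun t ht => ?_
    have h1 : ∀ᶠ p in 𝓝 (x₀, t), p ∈ W := hW.mem_nhds (hx t ht)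
    have h2 : ∀ᶠ p in 𝓝 (x₀, t), ‖F' p‖ < C + 1 :=
      (hF'.continuousAt (hW.mem_nhds (hx t ht))).norm.eventually_lt_const
        (by linarith [hC t ht])
    filter_upwards [h1, h2] with p hp hp' using ⟨hp, hp'.le⟩
  have hsub : uIoc (0 : ℝ) 1 ⊆ Icc 0 1 := by
    rw [uIoc_of_le zero_le_one]; exact Ioc_subset_Icc_self
  refine intervalIntegral.hasFDerivAt_integral_of_dominated_of_fderiv_le
    (F' := fun x t => F' (x, t)) (bound := fun _ => C + 1) hnear ?_ ?_ ?_ ?_ ?_ ?_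
  · filter_upwards [hnear] with x hx'
    exact ((hline x fun t ht => (hx' t ht).1).1.mono hsub).aestronglyMeasurable
      measurableSet_uIoc
  · exact (hline x₀ hx).1.intervalIntegrable_of_Icc zero_le_one
  · exact ((hline x₀ hx).2.mono hsub).aestronglyMeasurable measurableSet_uIoc
  · exact Eventually.of_forall fun t ht x hx' => (hx' t (hsub ht)).2
  · exact intervalIntegrable_const
  · exact Eventually.of_forall fun t ht x hx' => hderiv (x, t) (hx' t (hsub ht)).1

/-- The derivative is again an integral of a smooth integrand, now with values in a space of linear
maps. Hence the induction varies the target G. -/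
theorem contDiffOn_parametric_intervalIntegral_nat (n : ℕ) {G : Type} [NormedAddCommGroup G]
    [NormedSpace ℝ G] {F : E × ℝ → G} {W : Set (E × ℝ)} (hW : IsOpen W)
    (hF : ContDiffOn ℝ ∞ F W) {U : Set E} (hU : IsOpen U)
    (hUW : ∀ x ∈ U, ∀ t ∈ Icc (0 : ℝ) 1, (x, t) ∈ W) :
    ContDiffOn ℝ n (fun x => ∫ t in (0 : ℝ)..1, F (x, t)) U := by
  induction n generalizing G F with
  | zero =>
    refine contDiffOn_zero.2 fun x hx => ?_
    exact (hasFDerivAt_parametric_intervalIntegral hW hF (hUW x hx)).continuousAt.continuousWithinAt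
  | succ n ih =>
    have hF' : ContDiffOn ℝ ∞
        (fun p => (fderiv ℝ F p).comp (ContinuousLinearMap.inl ℝ E ℝ)) W :=
      (hF.fderiv_of_isOpen hW (by simp)).clm_comp contDiffOn_const
    rw [Nat.cast_succ, contDiffOn_succ_iff_fderiv_of_isOpen hU]
    refine ⟨fun x hx => (hasFDerivAt_parametric_intervalIntegral hW hF
      (hUW x hx)).differentiableAt.differentiableWithinAt, by simp, ?_⟩
    exact (ih hF').congr fun x hx =>
      (hasFDerivAt_parametric_intervalIntegral hW hF (hUW x hx)).fderiv

theorem contDiffOn_parametric_intervalIntegral {G : Type} [NormedAddCommGroup G]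
    [NormedSpace ℝ G] {F : E × ℝ → G} {W : Set (E × ℝ)} (hW : IsOpen W)
    (hF : ContDiffOn ℝ ∞ F W) {U : Set E} (hU : IsOpen U)
    (hUW : ∀ x ∈ U, ∀ t ∈ Icc (0 : ℝ) 1, (x, t) ∈ W) :
    ContDiffOn ℝ ∞ (fun x => ∫ t in (0 : ℝ)..1, F (x, t)) U :=
  contDiffOn_infty.2 fun n => contDiffOn_parametric_intervalIntegral_nat n hW hF hU hUW

theorem fderiv_parametric_intervalIntegral {G : Type} [NormedAddCommGroup G]
    [NormedSpace ℝ G] [CompleteSpace G] {F : E × ℝ → G} {W : Set (E × ℝ)} (hW : IsOpen W)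
    (hF : ContDiffOn ℝ ∞ F W) {x₀ : E} (hx : ∀ t ∈ Icc (0 : ℝ) 1, (x₀, t) ∈ W) (y : E)
    {f' : ℝ → G}
    (hf' : ∀ t ∈ Icc (0 : ℝ) 1, HasLineDerivAt ℝ (fun x => F (x, t)) (f' t) x₀ y) :
    fderiv ℝ (fun x => ∫ t in (0 : ℝ)..1, F (x, t)) x₀ y = ∫ t in (0 : ℝ)..1, f' t := by
  rw [(hasFDerivAt_parametric_intervalIntegral hW hF hx).fderiv,
    ContinuousLinearMap.intervalIntegral_apply]
  · refine intervalIntegral.integral_congr fun t ht => ?_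
    rw [uIcc_of_le zero_le_one] at ht
    have hd := ((hF.differentiableOn (by simp)).differentiableAt
      (hW.mem_nhds (hx t ht))).hasFDerivAt
    have hl : HasLineDerivAt ℝ (fun x => F (x, t))
        ((fderiv ℝ F (x₀, t)).comp (ContinuousLinearMap.inl ℝ E ℝ) y) x₀ y :=
      (hd.comp x₀ (hasFDerivAt_prodMk_left x₀ t)).hasLineDerivAt y
    exact HasDerivAt.unique hl (hf' t ht)
  · refine ContinuousOn.intervalIntegrable_of_Icc zero_le_one ?_
    exact ((hF.continuousOn_fderiv_of_isOpen hW (by simp)).comp (by fun_prop) hx).clm_comp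
      continuousOn_const

end ParametricIntegral

/-! ### An open neighbourhood of the positive definite matrices. -/

namespace QuantumStates

open Set Filter Topology Matrix

variable {c : ℕ}

/-- Matrices whose Hermitian part is positive definite. -/
def strictlyAccretive (c : ℕ) : Set (Mat c) :=
  {M | ∀ x : Fin c → ℂ, x ≠ 0 → 0 < (star x ⬝ᵥ M *ᵥ x).re}

theorem _root_.Matrix.PosDef.mem_strictlyAccretive {M : Mat c} (hM : M.PosDef) :
    M ∈ strictlyAccretive c := fun _ hx => hM.re_dotProduct_pos hx

theorem posDef_of_mem_strictlyAccretive {M : Mat c} (hM : M ∈ strictlyAccretive c)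
    (hH : M.IsHermitian) : M.PosDef := by
  refine Matrix.PosDef.of_dotProduct_mulVec_pos hH fun x hx => ?_
  rw [Complex.pos_iff]
  exact ⟨hM x hx, (hH.im_star_dotProduct_mulVec_self x).symm⟩

/-- By homogeneity it suffices to test unit vectors, and the unit sphere is compact. -/
theorem isOpen_strictlyAccretive : IsOpen (strictlyAccretive c) := by
  have h : strictlyAccretive c =
      {M | ∀ x ∈ Metric.sphere (0 : Fin c → ℂ) 1, 0 < (star x ⬝ᵥ M *ᵥ x).re} := by
    ext M
    refine ⟨fun h x hx => h x fun h0 => by simp [h0] at hx, fun h x hx => ?_⟩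
    have hn : 0 < ‖x‖ := norm_pos_iff.2 hx
    have h1 := h ((‖x‖⁻¹ : ℝ) • x) (by simp [norm_smul, hn.ne'])
    have h2 : star ((‖x‖⁻¹ : ℝ) • x) ⬝ᵥ M *ᵥ ((‖x‖⁻¹ : ℝ) • x)
        = (‖x‖⁻¹ * ‖x‖⁻¹ : ℝ) • (star x ⬝ᵥ M *ᵥ x) := by
      rw [star_smul, mulVec_smul, smul_dotProduct, dotProduct_smul, smul_smul, star_trivial]
    rw [h2, Complex.smul_re, smul_eq_mul] at h1
    exact (mul_pos_iff_of_pos_left (by positivity)).1 h1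
  rw [h, isOpen_iff_eventually]
  intro M hM
  refine (isCompact_sphere _ _).eventually_forall_of_forall_eventually fun x hx => ?_
  have hc : Continuous fun p : Mat c × (Fin c → ℂ) => (star p.2 ⬝ᵥ p.1 *ᵥ p.2).re := by
    exact Complex.continuous_re.comp
      ((continuous_snd.star).dotProduct (Continuous.matrix_mulVec continuous_fst continuous_snd))
  exact hc.continuousAt.eventually_const_lt (hM x hx)

theorem isUnit_of_mem_strictlyAccretive {M : Mat c} (hM : M ∈ strictlyAccretive c) :
    IsUnit M := by
  rw [← Matrix.mulVec_injective_iff_isUnit]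
  refine (injective_iff_map_eq_zero M.mulVecLin).2 ?_
  intro x hx
  by_contra h0
  have h := hM x h0
  rw [Matrix.mulVecLin_apply] at hx
  simp [hx] at h

theorem one_add_smul_mem_strictlyAccretive {M : Mat c} (hM : M ∈ strictlyAccretive c) {t : ℝ}
    (ht : t ∈ Icc (0 : ℝ) 1) : 1 + t • (M - 1) ∈ strictlyAccretive c := by
  intro x hx
  have h1 : (0 : ℝ) < (star x ⬝ᵥ (1 : Mat c) *ᵥ x).re :=
    Matrix.PosDef.one.mem_strictlyAccretive x hx
  have h2 := hM x hx
  have h3 : (1 : Mat c) + t • (M - 1) = (1 - t) • (1 : Mat c) + t • M := by module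
  rw [h3, add_mulVec, dotProduct_add, smul_mulVec, smul_mulVec, dotProduct_smul,
    dotProduct_smul, Complex.add_re, Complex.smul_re, Complex.smul_re, smul_eq_mul, smul_eq_mul]
  rcases ht.1.eq_or_lt with rfl | h0
  · simpa using h1
  · nlinarith [mul_nonneg (sub_nonneg.2 ht.2) h1.le, mul_pos h0 h2]

/-! ### The logarithm as a smooth integral. -/

noncomputable section

/-- The inverse of the convex combination `(1 - t) • 1 + t • M`. -/
def segInv (M : Mat c) (t : ℝ) : Mat c := (1 + t • (M - 1))⁻¹

/-- The integrand of the integral representation of the logarithm. -/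
def logKernel (p : Mat c × ℝ) : Mat c := (p.1 - 1) * segInv p.1 p.2

/-- The holomorphic logarithm, as the integral of `(M - 1) (1 + t (M - 1))⁻¹` over `[0, 1]`. -/
def logIntegral (M : Mat c) : Mat c := ∫ t in (0 : ℝ)..1, logKernel (M, t)

/-- The pairs `(M, t)` for which `segInv M t` is a genuine inverse. -/
def segDomain (c : ℕ) : Set (Mat c × ℝ) := {p | 1 + p.2 • (p.1 - 1) ∈ strictlyAccretive c}

theorem isOpen_segDomain : IsOpen (segDomain c) :=
  isOpen_strictlyAccretive.preimage (by fun_prop)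

theorem contDiffOn_segInv : ContDiffOn ℝ ∞ (fun p : Mat c × ℝ => segInv p.1 p.2)
    (segDomain c) := by
  intro p hp
  obtain ⟨u, hu⟩ := isUnit_of_mem_strictlyAccretive hp
  have h := contDiffAt_ringInverse ℝ (n := ∞) u
  rw [hu] at h
  have h2 := h.comp p (f := fun p : Mat c × ℝ => 1 + p.2 • (p.1 - 1)) (by fun_prop)
  refine ContDiffAt.contDiffWithinAt (h2.congr_of_eventuallyEq (Eventually.of_forall fun q => ?_))
  simp [segInv, Matrix.nonsing_inv_eq_ringInverse]

theorem contDiffOn_logKernel : ContDiffOn ℝ ∞ (logKernel (c := c)) (segDomain c) :=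
  (contDiffOn_fst.sub contDiffOn_const).mul contDiffOn_segInv

theorem contDiffOn_logIntegral : ContDiffOn ℝ ∞ (logIntegral (c := c)) (strictlyAccretive c) :=
  contDiffOn_parametric_intervalIntegral isOpen_segDomain contDiffOn_logKernel
    isOpen_strictlyAccretive
    fun _ hM _ ht => one_add_smul_mem_strictlyAccretive hM ht

theorem continuousOn_segInv {M : Mat c} (hM : M ∈ strictlyAccretive c) :
    ContinuousOn (segInv M) (Icc 0 1) :=
  contDiffOn_segInv.continuousOn.comp (f := fun t : ℝ => (M, t)) (by fun_prop)
    fun _ ht => one_add_smul_mem_strictlyAccretive hM ht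

theorem hasDerivAt_segInv {M : Mat c} {t : ℝ} (hM : (M, t) ∈ segDomain c) (Y : Mat c) :
    HasDerivAt (fun s : ℝ => (M + s • Y - 1) * segInv (M + s • Y) t)
      (segInv M t * Y * segInv M t) 0 := by
  set B : Mat c := 1 + t • (M - 1) with hB
  obtain ⟨u, hu⟩ := isUnit_of_mem_strictlyAccretive (show B ∈ strictlyAccretive c from hM)
  have hBu : ((u⁻¹ : (Mat c)ˣ) : Mat c) = segInv M t := by
    rw [segInv, ← hB, ← hu, Matrix.coe_units_inv]
  have h := hasFDerivAt_ringInverse (𝕜 := ℝ) u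
  rw [hBu] at h
  have hl : HasDerivAt (fun s : ℝ => 1 + t • (M + s • Y - 1)) (t • Y) 0 := by
    have := ((((hasDerivAt_id (0 : ℝ)).smul_const Y).const_add M).sub_const 1).const_smul t
      |>.const_add 1
    simpa using this
  have hl0 : (fun s : ℝ => 1 + t • (M + s • Y - 1)) 0 = u := by simp [hu, hB]
  rw [← hl0] at h
  have h2 := h.comp_hasDerivAt (0 : ℝ) hl
  have h3 : HasDerivAt (fun s : ℝ => M + s • Y - 1) Y 0 := by
    simpa using (((hasDerivAt_id (0 : ℝ)).smul_const Y).const_add M).sub_const 1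
  have h4 := h3.mul h2
  have h5 : (fun s : ℝ => (M + s • Y - 1) * segInv (M + s • Y) t) =
      (fun s : ℝ => M + s • Y - 1) * (Ring.inverse ∘ fun s : ℝ => 1 + t • (M + s • Y - 1)) := by
    ext1 s
    simp [segInv, Matrix.nonsing_inv_eq_ringInverse]
  rw [h5]
  refine h4.congr_deriv ?_
  have hK : B * segInv M t = 1 := by rw [← hu, ← hBu, Units.mul_inv]
  have h6 : Ring.inverse (1 + t • (M - 1)) = segInv M t := by
    simp [segInv, Matrix.nonsing_inv_eq_ringInverse]
  rw [hB, add_mul, smul_mul_assoc, one_mul] at hK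
  -- With K = `segInv M t`, the product rule gives YK - t(M - 1)KYK = (1 - t(M - 1)K)YK, and the
  -- bracket is K itself.
  have h7 : segInv M t = 1 - t • ((M - 1) * segInv M t) := eq_sub_of_add_eq hK
  simp only [Function.comp_apply, zero_smul, add_zero, h6]
  calc _ = (1 - t • ((M - 1) * segInv M t)) * Y * segInv M t := by
          simp [mul_assoc, sub_eq_add_neg, add_mul]
    _ = _ := by rw [← h7]

theorem fderiv_logIntegral {M : Mat c} (hM : M ∈ strictlyAccretive c) (Y : Mat c) :
    fderiv ℝ logIntegral M Y = ∫ t in (0 : ℝ)..1, segInv M t * Y * segInv M t :=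
  fderiv_parametric_intervalIntegral isOpen_segDomain contDiffOn_logKernel
    (fun _ ht => one_add_smul_mem_strictlyAccretive hM ht) Y
    fun _ ht => hasDerivAt_segInv (one_add_smul_mem_strictlyAccretive hM ht) Y

theorem integral_log_kernel {x : ℝ} (hx : 0 < x) :
    ∫ t in (0 : ℝ)..1, (x - 1) * (1 + t * (x - 1))⁻¹ = Real.log x := by
  have hpos : ∀ t ∈ Icc (0 : ℝ) 1, 0 < 1 + t * (x - 1) := fun t ht => by
    rcases ht.1.eq_or_lt with rfl | h0
    · simp
    · nlinarith [ht.2, mul_pos h0 hx]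
  rw [intervalIntegral.integral_eq_sub_of_hasDerivAt
    (f := fun t => Real.log (1 + t * (x - 1)))]
  · simp
  · intro t ht
    rw [uIcc_of_le zero_le_one] at ht
    have h1 : HasDerivAt (fun t : ℝ => 1 + t * (x - 1)) (x - 1) t := by
      simpa using ((hasDerivAt_id t).mul_const (x - 1)).const_add 1
    simpa [div_eq_mul_inv] using h1.log (hpos t ht).ne'
  · refine ContinuousOn.intervalIntegrable_of_Icc zero_le_one ?_
    exact continuousOn_const.mul (ContinuousOn.inv₀ (by fun_prop) fun t ht => (hpos t ht).ne')

/-- D conjugates a real diagonal matrix by an eigenvector unitary. Being linear and multiplicative,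
it reduces identities between functions of ρ to scalar identities at the eigenvalues. -/
theorem exists_diagonalization {ρ : Mat c} (hρ : ρ.PosDef) :
    ∃ (D : (Fin c → ℝ) →ₗ[ℝ] Mat c) (l : Fin c → ℝ), (∀ i, 0 < l i) ∧
      (∀ a b, D a * D b = D (a * b)) ∧ D 1 = 1 ∧ D l = ρ ∧
      logm ρ = D fun i => Real.log (l i) := by
  have hH := hρ.isHermitian
  set e := Unitary.conjStarAlgAut ℂ (Mat c) hH.eigenvectorUnitary with he
  let D : (Fin c → ℝ) →ₗ[ℝ] Mat c :=
    { toFun := fun d => e (diagonal fun i => (d i : ℂ))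
      map_add' := fun a b => by
        rw [← map_add, diagonal_add]; simp
      map_smul' := fun a b => by
        have h1 : (diagonal fun i => (((a • b) i : ℝ) : ℂ)) =
            (a : ℂ) • (diagonal fun i => (b i : ℂ) : Mat c) := by
          rw [← diagonal_smul]; congr 1; ext i; simp
        rw [h1, map_smul]; rfl }
  refine ⟨D, hH.eigenvalues, hρ.eigenvalues_pos, fun a b => ?_, ?_, hH.spectral_theorem.symm,
    hH.cfc_eq Real.log⟩
  · change e _ * e _ = e _
    rw [← map_mul, diagonal_mul_diagonal]; simp
  · change e _ = 1
    rw [← map_one e]; congr 1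

theorem logm_eq_logIntegral {ρ : Mat c} (hρ : ρ.PosDef) : logm ρ = logIntegral ρ := by
  obtain ⟨D, l, hl, hDmul, hDone, hDρ, hlog⟩ := exists_diagonalization hρ
  have hne : ∀ t ∈ Icc (0 : ℝ) 1, ∀ i, 1 + t * (l i - 1) ≠ 0 := fun t ht i => by
    rcases ht.1.eq_or_lt with rfl | ht0
    · simp
    · nlinarith [ht.2, mul_pos ht0 (hl i)]
  have hker : ∀ t ∈ Icc (0 : ℝ) 1, logKernel (ρ, t) =
      D fun i => (l i - 1) * (1 + t * (l i - 1))⁻¹ := by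
    intro t ht
    have hinv : segInv ρ t = D fun i => (1 + t * (l i - 1))⁻¹ := by
      refine Matrix.inv_eq_right_inv ?_
      rw [← hDρ, ← hDone, ← map_sub, ← map_smul, ← map_add, hDmul]
      congr 1
      ext i
      simp [hne t ht i]
    rw [logKernel, hinv, ← hDρ, ← hDone, ← map_sub, hDmul]
    rfl
  have hcont : ContinuousOn (fun t : ℝ => fun i : Fin c =>
      (l i - 1) * (1 + t * (l i - 1))⁻¹) (Icc 0 1) :=
    continuousOn_pi.2 fun i => continuousOn_const.mul
      (ContinuousOn.inv₀ (by fun_prop) fun t ht => hne t ht i)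
  have hint := hcont.intervalIntegrable_of_Icc (μ := MeasureTheory.volume) zero_le_one
  have h1 : logIntegral ρ = ∫ t in (0 : ℝ)..1, LinearMap.toContinuousLinearMap D fun i =>
      (l i - 1) * (1 + t * (l i - 1))⁻¹ := by
    refine intervalIntegral.integral_congr fun t ht => ?_
    rw [uIcc_of_le zero_le_one] at ht
    exact hker t ht
  rw [h1, ContinuousLinearMap.intervalIntegral_comp_comm _ hint, hlog]
  change D _ = D _
  congr 1
  ext i
  have h2 := ContinuousLinearMap.intervalIntegral_comp_comm
    (ContinuousLinearMap.proj (R := ℝ) (φ := fun _ : Fin c => ℝ) i) hint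
  rw [← integral_log_kernel (hl i)]
  exact h2

/-! ### Density matrices, tangent directions and the traceless projection. -/

theorem ne_zero_of_mem_densityMatrices {ρ : Mat c} (hρ : ρ ∈ densityMatrices c) : c ≠ 0 := by
  rintro rfl
  simpa using hρ.2

theorem eventually_add_smul_mem_densityMatrices {ρ X : Mat c} (hρ : ρ ∈ densityMatrices c)
    (hX : X ∈ tracelessHermitian c) : ∀ᶠ t : ℝ in 𝓝 0, ρ + t • X ∈ densityMatrices c := by
  have hc : ContinuousAt (fun t : ℝ => ρ + t • X) 0 := by fun_prop
  have h0 : ρ + (0 : ℝ) • X ∈ strictlyAccretive c := by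
    simpa using hρ.1.mem_strictlyAccretive
  filter_upwards [hc (isOpen_strictlyAccretive.mem_nhds h0)] with t ht
  refine ⟨posDef_of_mem_strictlyAccretive ht ?_, ?_⟩
  · exact hρ.1.isHermitian.add ((tracelessHermitian c).smul_mem t hX).1
  · rw [trace_add, hρ.2, ((tracelessHermitian c).smul_mem t hX).2, add_zero]

/-- The linear map whose kernel is the space of traceless Hermitian matrices. -/
def hermitianTraceDefect (c : ℕ) : Mat c →L[ℝ] Mat c × ℂ :=
  LinearMap.toContinuousLinearMap
    { toFun := fun M => (Mᴴ - M, M.trace)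
      map_add' := fun A B => by
        ext1
        · simp only [conjTranspose_add, Prod.mk_add_mk]; abel
        · simp
      map_smul' := fun a A => by
        ext1
        · simp [conjTranspose_smul, smul_sub]
        · simp }

theorem hermitianTraceDefect_eq_zero {M : Mat c} :
    hermitianTraceDefect c M = 0 ↔ M ∈ tracelessHermitian c := by
  change (Mᴴ - M, M.trace) = 0 ↔ _
  rw [Prod.mk_eq_zero, sub_eq_zero]
  rfl

/-- The linear defect is constant along γ, so it kills the derivative. -/
theorem mem_tracelessHermitian_of_hasDerivWithinAt {γ : ℝ → Mat c} {v : Mat c} {J : Set ℝ} {t : ℝ}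
    (hJ : UniqueDiffWithinAt ℝ J t) (hγ : HasDerivWithinAt γ v J t)
    (hmem : ∀ s ∈ J, γ s - γ t ∈ tracelessHermitian c) : v ∈ tracelessHermitian c := by
  rw [← hermitianTraceDefect_eq_zero]
  have h1 := (hermitianTraceDefect c).hasFDerivAt.comp_hasDerivWithinAt t hγ
  have h2 : HasDerivWithinAt (hermitianTraceDefect c ∘ γ) 0 J t := by
    refine (hasDerivWithinAt_const t J (hermitianTraceDefect c (γ t))).congr (fun s hs => ?_) rfl
    have := hermitianTraceDefect_eq_zero.2 (hmem s hs)
    rwa [map_sub, sub_eq_zero] at this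
  exact hJ.eq_deriv _ h1 h2

theorem sub_mem_tracelessHermitian {ρ σ : Mat c} (hρ : ρ ∈ densityMatrices c)
    (hσ : σ ∈ densityMatrices c) : ρ - σ ∈ tracelessHermitian c :=
  ⟨hρ.1.isHermitian.sub hσ.1.isHermitian, by rw [trace_sub, hρ.2, hσ.2, sub_self]⟩

/-- `projTraceless` as a continuous real-linear map. -/
def projTracelessL (c : ℕ) : Mat c →L[ℝ] Mat c :=
  LinearMap.toContinuousLinearMap
    { toFun := projTraceless
      map_add' := fun A B => by
        simp only [projTraceless, trace_add, add_div, add_smul]; abel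
      map_smul' := fun a A => by
        simp only [projTraceless, trace_smul, smul_sub, RingHom.id_apply]
        congr 1
        rw [← smul_assoc]
        congr 1
        simp [mul_div_assoc] }

theorem projTracelessL_apply (M : Mat c) : projTracelessL c M = projTraceless M := rfl

theorem projTraceless_eq_self {M : Mat c} (h : M.trace = 0) : projTraceless M = M := by
  simp [projTraceless, h]

theorem projTraceless_mem (hc : c ≠ 0) {M : Mat c} (h : M.IsHermitian) :
    projTraceless M ∈ tracelessHermitian c := by
  have hc' : (c : ℂ) ≠ 0 := Nat.cast_ne_zero.2 hc
  refine ⟨h.sub ?_, ?_⟩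
  · have htr : star M.trace = M.trace := by
      rw [← trace_conjTranspose, h.eq]
    change conjTranspose _ = _
    rw [conjTranspose_smul, conjTranspose_one, star_div₀, htr, star_natCast]
  · simp [projTraceless, trace_sub, trace_smul, hc']

/-! ### The exponential chart and its inverse Γ. -/

/-- The exponential coordinate chart `ρ ↦ log ρ - (tr (log ρ) / c) I`. -/
def eChart (M : Mat c) : Mat c := projTracelessL c (logIntegral M)

theorem contDiffOn_eChart : ContDiffOn ℝ ∞ (eChart (c := c)) (strictlyAccretive c) :=
  (projTracelessL c).contDiff.comp_contDiffOn contDiffOn_logIntegral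

theorem densityMatrices_subset : densityMatrices c ⊆ strictlyAccretive c :=
  fun _ h => h.1.mem_strictlyAccretive

theorem eChart_eq_projTraceless_logm {ρ : Mat c} (hρ : ρ.PosDef) :
    eChart ρ = projTraceless (logm ρ) := by
  rw [eChart, logm_eq_logIntegral hρ, projTracelessL_apply]

theorem eChart_mem {ρ : Mat c} (hρ : ρ ∈ densityMatrices c) : eChart ρ ∈ tracelessHermitian c := by
  rw [eChart_eq_projTraceless_logm hρ.1]
  exact projTraceless_mem (ne_zero_of_mem_densityMatrices hρ) IsSelfAdjoint.log

/-- exp H = BB* with B = exp(H/2) invertible. -/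
theorem posDef_exp {H : Mat c} (hH : H.IsHermitian) : (NormedSpace.exp H).PosDef := by
  have h1 : (NormedSpace.exp H).IsHermitian := hH.exp
  have h2 : NormedSpace.exp H =
      NormedSpace.exp ((2⁻¹ : ℝ) • H) * (NormedSpace.exp ((2⁻¹ : ℝ) • H))ᴴ := by
    have h3 : ((2⁻¹ : ℝ) • H).IsHermitian := by
      change conjTranspose _ = _
      rw [conjTranspose_smul, hH.eq, star_trivial]
    rw [h3.exp.eq, ← Matrix.exp_add_of_commute _ _ (Commute.refl _), ← add_smul]
    norm_num
  rw [h2]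
  refine Matrix.PosDef.mul_conjTranspose_self _ ?_
  rw [Matrix.vecMul_injective_iff_isUnit]
  exact Matrix.isUnit_exp _

theorem trace_exp_eq {H : Mat c} (hc : c ≠ 0) (hH : H.IsHermitian) :
    ∃ r : ℝ, 0 < r ∧ (NormedSpace.exp H).trace = r := by
  have : Nonempty (Fin c) := ⟨⟨0, Nat.pos_of_ne_zero hc⟩⟩
  have h := (posDef_exp hH).trace_pos
  rw [Complex.pos_iff] at h
  exact ⟨_, h.1, Complex.ext rfl h.2.symm⟩

theorem Gam_mem {H : Mat c} (hc : c ≠ 0) (hH : H.IsHermitian) : Gam H ∈ densityMatrices c := by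
  obtain ⟨r, hr, hr'⟩ := trace_exp_eq hc hH
  refine ⟨?_, ?_⟩
  · rw [Gam, hr']
    refine (posDef_exp hH).smul ?_
    rw [← Complex.ofReal_inv]
    exact_mod_cast inv_pos.2 hr
  · rw [Gam, trace_smul, hr', smul_eq_mul, inv_mul_cancel₀]
    exact_mod_cast hr.ne'

theorem algebraMap_real_eq (r : ℝ) : algebraMap ℝ (Mat c) r = (r : ℂ) • (1 : Mat c) := by
  rw [Algebra.algebraMap_eq_smul_one]; rfl

theorem projTraceless_add_smul_one (hc : c ≠ 0) (a : ℂ) (M : Mat c) :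
    projTraceless (a • (1 : Mat c) + M) = projTraceless M := by
  have hc' : (c : ℂ) ≠ 0 := Nat.cast_ne_zero.2 hc
  simp only [projTraceless, trace_add, trace_smul, trace_one, Fintype.card_fin, smul_eq_mul,
    add_div, mul_div_cancel_right₀ a hc', add_smul]
  abel

/-- Normalizing exp H adds only a scalar matrix to its logarithm, and the projection removes it. -/
theorem eChart_Gam {H : Mat c} (hc : c ≠ 0) (hH : H ∈ tracelessHermitian c) :
    eChart (Gam H) = H := by
  obtain ⟨r, hr, hr'⟩ := trace_exp_eq hc hH.1
  rw [eChart_eq_projTraceless_logm (Gam_mem hc hH.1).1]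
  have h1 : Gam H = r⁻¹ • NormedSpace.exp H := by
    rw [Gam, hr', ← Complex.ofReal_inv]; rfl
  have h2 : logm (Gam H) = algebraMap ℝ (Mat c) (Real.log r⁻¹) + H := by
    open scoped MatrixOrder in
    rw [h1, logm, CFC.log_smul' _ (inv_pos.2 hr) (posDef_exp hH.1).isStrictlyPositive,
      CFC.log_exp H hH.1]
  rw [h2, algebraMap_real_eq, projTraceless_add_smul_one hc, projTraceless_eq_self hH.2]

/-- Removing the scalar part of log ρ multiplies the exponential by a nonzero number, which the
normalization divides out. -/
theorem Gam_eChart {ρ : Mat c} (hρ : ρ ∈ densityMatrices c) : Gam (eChart ρ) = ρ := by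
  have hexp : NormedSpace.exp (logm ρ) = ρ := by
    open scoped MatrixOrder in
    exact CFC.exp_log ρ hρ.1.isStrictlyPositive
  have h1 : NormedSpace.exp (eChart ρ) = Complex.exp (-((logm ρ).trace / c)) • ρ := by
    rw [eChart_eq_projTraceless_logm hρ.1, projTraceless, sub_eq_add_neg, ← neg_smul,
      Matrix.exp_add_of_commute _ _ ((Commute.one_right _).smul_right _), hexp]
    have h2 : ∀ a : ℂ, NormedSpace.exp (a • (1 : Mat c)) = Complex.exp a • (1 : Mat c) := by
      intro a
      rw [← Matrix.diagonal_one, ← Matrix.diagonal_smul, Matrix.exp_diagonal,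
        ← Matrix.diagonal_smul, Complex.exp_eq_exp_ℂ]
      congr 1
      ext i
      simp
    rw [h2, mul_smul_comm, mul_one]
  rw [Gam, h1, trace_smul, hρ.2, smul_smul, smul_eq_mul, mul_one,
    inv_mul_cancel₀ (Complex.exp_ne_zero _), one_smul]

theorem GamInv_eq_eChart {ρ : Mat c} (hρ : ρ ∈ densityMatrices c) : GamInv ρ = eChart ρ := by
  have h : ∃ H ∈ (tracelessHermitian c : Set (Mat c)), Gam H = ρ :=
    ⟨eChart ρ, eChart_mem hρ, Gam_eChart hρ⟩
  have h1 : GamInv ρ ∈ tracelessHermitian c := Function.invFunOn_mem h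
  have h2 : Gam (GamInv ρ) = ρ := Function.invFunOn_eq h
  conv_rhs => rw [← h2]
  exact (eChart_Gam (ne_zero_of_mem_densityMatrices hρ) h1).symm

/-- The open domain on which `Gam` is smooth. -/
def gamDomain (c : ℕ) : Set (Mat c) := {H | (NormedSpace.exp H).trace ≠ 0}

theorem contDiff_exp_mat : ContDiff ℝ ∞ (NormedSpace.exp : Mat c → Mat c) :=
  contDiff_iff_contDiffAt.2 fun x => (NormedSpace.exp_analytic (𝕂 := ℝ) x).contDiffAt

theorem contDiff_trace_exp : ContDiff ℝ ∞ fun H : Mat c => (NormedSpace.exp H).trace :=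
  (LinearMap.toContinuousLinearMap (traceLinearMap (Fin c) ℝ ℂ)).contDiff.comp contDiff_exp_mat

theorem isOpen_gamDomain : IsOpen (gamDomain c) :=
  isOpen_ne.preimage contDiff_trace_exp.continuous

theorem contDiffOn_Gam : ContDiffOn ℝ ∞ (Gam (c := c)) (gamDomain c) :=
  (contDiff_trace_exp.contDiffOn.inv fun _ h => h).smul contDiff_exp_mat.contDiffOn

theorem mem_gamDomain {H : Mat c} (hc : c ≠ 0) (hH : H.IsHermitian) : H ∈ gamDomain c := by
  obtain ⟨r, hr, hr'⟩ := trace_exp_eq hc hH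
  change _ ≠ _
  rw [hr']
  exact_mod_cast hr.ne'

/-! ### The BKM metric as a trace pairing with the differential of log. -/

/-- The trace pairing `re tr (X Y)` as a bilinear map. -/
def tracePairing (X : Mat c) : Mat c →L[ℝ] ℝ :=
  Complex.reCLM.comp
    ((LinearMap.toContinuousLinearMap (traceLinearMap (Fin c) ℝ ℂ)).comp
      (LinearMap.toContinuousLinearMap (LinearMap.mulLeft ℝ X)))

theorem tracePairing_apply (X Y : Mat c) : tracePairing X Y = (X * Y).trace.re := rfl

theorem image_inv_sub_one : (fun t : ℝ => t⁻¹ - 1) '' Ioo 0 1 = Ioi 0 := by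
  ext s
  constructor
  · rintro ⟨t, ht, rfl⟩
    exact sub_pos.2 ((one_lt_inv₀ ht.1).2 ht.2)
  · intro hs
    have hs' : 0 < s := hs
    refine ⟨(s + 1)⁻¹, ⟨by positivity, inv_lt_one_of_one_lt₀ (by linarith)⟩, by simp⟩

theorem inv_add_smul_eq_segInv {ρ : Mat c} {t : ℝ} (ht : 0 < t) :
    (ρ + ((t⁻¹ - 1 : ℝ) : ℂ) • (1 : Mat c))⁻¹ = (t : ℂ) • segInv ρ t := by
  have ht' : (t : ℂ) ≠ 0 := by exact_mod_cast ht.ne'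
  have h1 : ρ + ((t⁻¹ - 1 : ℝ) : ℂ) • (1 : Mat c) = (t : ℂ)⁻¹ • (1 + t • (ρ - 1)) := by
    have h2 : t • (ρ - 1) = (t : ℂ) • (ρ - 1) := rfl
    rw [h2, smul_add, smul_smul, inv_mul_cancel₀ ht', one_smul]
    push_cast
    module
  have : Invertible (t : ℂ)⁻¹ := invertibleOfNonzero (inv_ne_zero ht')
  rw [h1, segInv]
  -- No invertibility is assumed: in the singular case both inverses are 0 by convention.
  by_cases hd : IsUnit (1 + t • (ρ - 1) : Mat c).det
  · rw [Matrix.inv_smul _ _ hd]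
    simp
  · rw [Matrix.nonsing_inv_apply_not_isUnit _ hd, Matrix.nonsing_inv_apply_not_isUnit, smul_zero]
    rw [Matrix.det_smul, IsUnit.mul_iff]
    exact fun h => hd h.2

/-- Substitute s = 1/t - 1. Each resolvent contributes a factor t, and together they cancel the
Jacobian 1/t². -/
theorem bkm_eq_integral (ρ X Y : Mat c) :
    bkm ρ X Y = ∫ t in (0 : ℝ)..1, tracePairing X (segInv ρ t * Y * segInv ρ t) := by
  have hderiv : ∀ t ∈ Ioo (0 : ℝ) 1,
      HasDerivWithinAt (fun t : ℝ => t⁻¹ - 1) (-(t ^ 2)⁻¹) (Ioo 0 1) t := fun t ht =>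
    ((hasDerivAt_inv ht.1.ne').sub_const 1).hasDerivWithinAt
  have hinj : InjOn (fun t : ℝ => t⁻¹ - 1) (Ioo 0 1) := fun a _ b _ h => by
    simpa using h
  rw [bkm, ← image_inv_sub_one,
    MeasureTheory.integral_image_eq_integral_abs_deriv_smul measurableSet_Ioo hderiv hinj,
    intervalIntegral.integral_of_le zero_le_one, MeasureTheory.integral_Ioc_eq_integral_Ioo]
  refine MeasureTheory.setIntegral_congr_fun measurableSet_Ioo fun t ht => ?_
  have ht0 : t ≠ 0 := ht.1.ne'
  rw [inv_add_smul_eq_segInv ht.1, tracePairing_apply]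
  simp only [mul_smul_comm, smul_mul_assoc, smul_smul, trace_smul, smul_eq_mul]
  rw [← Complex.ofReal_mul, Complex.re_ofReal_mul, abs_neg, abs_of_pos (by positivity),
    ← mul_assoc, ← sq, inv_mul_cancel₀ (by positivity), one_mul]
  simp only [mul_assoc]

theorem bkm_comm (ρ X Y : Mat c) : bkm ρ X Y = bkm ρ Y X := by
  rw [bkm_eq_integral, bkm_eq_integral]
  refine intervalIntegral.integral_congr fun t _ => ?_
  simp only [tracePairing_apply]
  rw [trace_mul_comm X, mul_assoc, mul_assoc, trace_mul_comm]
  simp only [mul_assoc]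

theorem bkm_eq_tracePairing {ρ : Mat c} (hρ : ρ ∈ strictlyAccretive c) (X Y : Mat c) :
    bkm ρ X Y = tracePairing X (fderiv ℝ logIntegral ρ Y) := by
  rw [bkm_eq_integral, fderiv_logIntegral hρ,
    ContinuousLinearMap.intervalIntegral_comp_comm]
  exact ((continuousOn_segInv hρ).mul continuousOn_const |>.mul
    (continuousOn_segInv hρ)).intervalIntegrable_of_Icc zero_le_one

theorem fderiv_eChart {ρ : Mat c} (hρ : ρ ∈ strictlyAccretive c) (X : Mat c) :
    fderiv ℝ eChart ρ X = projTraceless (fderiv ℝ logIntegral ρ X) := by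
  have h : HasFDerivAt eChart ((projTracelessL c).comp (fderiv ℝ logIntegral ρ)) ρ :=
    (projTracelessL c).hasFDerivAt.comp ρ ((contDiffOn_logIntegral.differentiableOn
      (by simp)).differentiableAt (isOpen_strictlyAccretive.mem_nhds hρ)).hasFDerivAt
  rw [h.fderiv]; rfl

theorem tracePairing_projTraceless {X : Mat c} (hX : X.trace = 0) (Y : Mat c) :
    tracePairing X (projTraceless Y) = tracePairing X Y := by
  simp [tracePairing_apply, projTraceless, mul_sub, trace_sub, trace_smul, hX]

theorem bkm_eq_tracePairing_eChart {ρ : Mat c} (hρ : ρ ∈ strictlyAccretive c) (Y : Mat c)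
    {Z : Mat c} (hZ : Z ∈ tracelessHermitian c) :
    bkm ρ Y Z = tracePairing Z (fderiv ℝ eChart ρ Y) := by
  rw [bkm_comm, bkm_eq_tracePairing hρ, fderiv_eChart hρ, tracePairing_projTraceless hZ.2]

/-- For Hermitian A, tr(A²) = tr(A*A) is the squared Hilbert–Schmidt norm. -/
theorem eq_zero_of_tracePairing {A : Mat c} (hA : A ∈ tracelessHermitian c)
    (h : tracePairing A A = 0) : A = 0 := by
  rw [← Matrix.trace_conjTranspose_mul_self_eq_zero_iff, hA.1.eq]
  refine Complex.ext h ?_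
  have h1 : star (A * A).trace = (A * A).trace := by
    rw [← trace_conjTranspose, conjTranspose_mul, hA.1.eq]
  simpa using Complex.conj_eq_iff_im.1 h1

/-! ### Differentials of the chart and of Γ. -/

theorem hasFDerivAt_eChart {ρ : Mat c} (hρ : ρ ∈ densityMatrices c) :
    HasFDerivAt eChart (fderiv ℝ eChart ρ) ρ :=
  ((contDiffOn_eChart.differentiableOn (by simp)).differentiableAt
    (isOpen_strictlyAccretive.mem_nhds (densityMatrices_subset hρ))).hasFDerivAt

theorem hasFDerivAt_Gam {H : Mat c} (hc : c ≠ 0) (hH : H ∈ tracelessHermitian c) :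
    HasFDerivAt Gam (fderiv ℝ Gam H) H :=
  ((contDiffOn_Gam.differentiableOn (by simp)).differentiableAt
    (isOpen_gamDomain.mem_nhds (mem_gamDomain hc hH.1))).hasFDerivAt

theorem hasDerivAt_add_smul (M X : Mat c) : HasDerivAt (fun t : ℝ => M + t • X) X 0 := by
  simpa using ((hasDerivAt_id (0 : ℝ)).smul_const X).const_add M

theorem hasDerivAt_eChart_line {ρ : Mat c} (hρ : ρ ∈ densityMatrices c) (X : Mat c) :
    HasDerivAt (fun t : ℝ => eChart (ρ + t • X)) (fderiv ℝ eChart ρ X) 0 :=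
  (hasFDerivAt_eChart hρ).hasLineDerivAt X

theorem fderiv_eChart_mem {ρ X : Mat c} (hρ : ρ ∈ densityMatrices c)
    (hX : X ∈ tracelessHermitian c) : fderiv ℝ eChart ρ X ∈ tracelessHermitian c := by
  have hev := eventually_add_smul_mem_densityMatrices hρ hX
  refine mem_tracelessHermitian_of_hasDerivWithinAt (uniqueDiffWithinAt_of_mem_nhds hev)
    (hasDerivAt_eChart_line hρ X).hasDerivWithinAt fun s hs => ?_
  exact (tracelessHermitian c).sub_mem (eChart_mem hs) (by simpa using eChart_mem hρ)

/-- Chain rule for Γ ∘ θ = id along ρ + tX. That identity is available only on density matrices, so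
only tangent directions X are allowed. -/
theorem fderiv_Gam_fderiv_eChart {ρ X : Mat c} (hρ : ρ ∈ densityMatrices c)
    (hX : X ∈ tracelessHermitian c) :
    fderiv ℝ Gam (eChart ρ) (fderiv ℝ eChart ρ X) = X := by
  have h1 := hasDerivAt_eChart_line hρ X
  have h2 : HasFDerivAt Gam (fderiv ℝ Gam (eChart ρ)) (eChart (ρ + (0 : ℝ) • X)) := by
    rw [zero_smul, add_zero]
    exact hasFDerivAt_Gam (ne_zero_of_mem_densityMatrices hρ) (eChart_mem hρ)
  have h3 := h2.comp_hasDerivAt (0 : ℝ) h1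
  have h4 : HasDerivAt (Gam ∘ fun t : ℝ => eChart (ρ + t • X)) X 0 :=
    (hasDerivAt_add_smul ρ X).congr_of_eventuallyEq <| by
      filter_upwards [eventually_add_smul_mem_densityMatrices hρ hX] with t ht
      exact Gam_eChart ht
  exact h3.unique h4

theorem hasDerivAt_Gam_line {H A : Mat c} (hc : c ≠ 0) (hH : H ∈ tracelessHermitian c)
    (hA : A ∈ tracelessHermitian c) (t : ℝ) :
    HasDerivAt (fun s : ℝ => Gam (H + s • A)) (fderiv ℝ Gam (H + t • A) A) t := by
  have h1 : HasDerivAt (fun s : ℝ => H + s • A) A t := by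
    simpa using ((hasDerivAt_id t).smul_const A).const_add H
  exact (hasFDerivAt_Gam hc ((tracelessHermitian c).add_mem hH
    ((tracelessHermitian c).smul_mem t hA))).comp_hasDerivAt t h1

theorem fderiv_Gam_mem {H A : Mat c} (hc : c ≠ 0) (hH : H ∈ tracelessHermitian c)
    (hA : A ∈ tracelessHermitian c) : fderiv ℝ Gam H A ∈ tracelessHermitian c := by
  have h := hasDerivAt_Gam_line hc hH hA 0
  rw [zero_smul, add_zero] at h
  refine mem_tracelessHermitian_of_hasDerivWithinAt (uniqueDiffWithinAt_univ)
    h.hasDerivWithinAt fun s _ => ?_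
  have hmem : ∀ t : ℝ, Gam (H + t • A) ∈ densityMatrices c := fun t =>
    Gam_mem hc ((tracelessHermitian c).add_mem hH ((tracelessHermitian c).smul_mem t hA)).1
  exact sub_mem_tracelessHermitian (hmem s) (hmem 0)

theorem fderiv_eChart_fderiv_Gam {H A : Mat c} (hc : c ≠ 0) (hH : H ∈ tracelessHermitian c)
    (hA : A ∈ tracelessHermitian c) :
    fderiv ℝ eChart (Gam H) (fderiv ℝ Gam H A) = A := by
  have h1 := hasDerivAt_Gam_line hc hH hA 0
  rw [zero_smul, add_zero] at h1
  have h2 : HasFDerivAt eChart (fderiv ℝ eChart (Gam H)) (Gam (H + (0 : ℝ) • A)) := by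
    rw [zero_smul, add_zero]
    exact hasFDerivAt_eChart (Gam_mem hc hH.1)
  have h3 := h2.comp_hasDerivAt (0 : ℝ) h1
  have h4 : HasDerivAt (eChart ∘ fun s : ℝ => Gam (H + s • A)) A 0 :=
    (hasDerivAt_add_smul H A).congr_of_eventuallyEq <| Eventually.of_forall fun t =>
      eChart_Gam hc ((tracelessHermitian c).add_mem hH ((tracelessHermitian c).smul_mem t hA))
  exact h3.unique h4

theorem opT_eq {ρ X : Mat c} (hρ : ρ ∈ densityMatrices c) (hX : X ∈ tracelessHermitian c) :
    opT ρ X = fderiv ℝ logIntegral ρ X := by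
  have h1 : HasLineDerivAt ℝ logIntegral (fderiv ℝ logIntegral ρ X) ρ X :=
    ((contDiffOn_logIntegral.differentiableOn (by simp)).differentiableAt
      (isOpen_strictlyAccretive.mem_nhds (densityMatrices_subset hρ))).hasFDerivAt.hasLineDerivAt X
  have h2 : HasLineDerivAt ℝ logm (fderiv ℝ logIntegral ρ X) ρ X :=
    HasDerivAt.congr_of_eventuallyEq h1 <| by
      filter_upwards [eventually_add_smul_mem_densityMatrices hρ hX] with t ht
      exact logm_eq_logIntegral ht.1
  exact h2.lineDeriv

theorem projTraceless_opT {ρ X : Mat c} (hρ : ρ ∈ densityMatrices c)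
    (hX : X ∈ tracelessHermitian c) : projTraceless (opT ρ X) = fderiv ℝ eChart ρ X := by
  rw [opT_eq hρ hX, fderiv_eChart (densityMatrices_subset hρ)]

theorem dGamInv_eq {ρ X : Mat c} (hρ : ρ ∈ densityMatrices c) (hX : X ∈ tracelessHermitian c) :
    dGamInv ρ X = fderiv ℝ eChart ρ X := by
  have h2 : HasLineDerivAt ℝ GamInv (fderiv ℝ eChart ρ X) ρ X :=
    HasDerivAt.congr_of_eventuallyEq (hasDerivAt_eChart_line hρ X) <| by
      filter_upwards [eventually_add_smul_mem_densityMatrices hρ hX] with t ht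
      exact GamInv_eq_eChart ht
  exact h2.lineDeriv

/-! ### Calculus for functions controlled only on density matrices. -/

/-- The Hermitian part, as a continuous real-linear map. -/
def hermitianPart (c : ℕ) : Mat c →L[ℝ] Mat c :=
  LinearMap.toContinuousLinearMap
    { toFun := fun M => (2⁻¹ : ℝ) • (M + Mᴴ)
      map_add' := fun A B => by
        simp only [conjTranspose_add]; module
      map_smul' := fun a A => by
        simp only [conjTranspose_smul, star_trivial, RingHom.id_apply]; module }

theorem hermitianPart_apply (M : Mat c) : hermitianPart c M = (2⁻¹ : ℝ) • (M + Mᴴ) := rfl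

theorem isHermitian_hermitianPart (M : Mat c) : (hermitianPart c M).IsHermitian := by
  change conjTranspose _ = _
  rw [hermitianPart_apply, conjTranspose_smul, conjTranspose_add, conjTranspose_conjTranspose,
    star_trivial, add_comm]

theorem hermitianPart_eq_self {M : Mat c} (h : M.IsHermitian) : hermitianPart c M = M := by
  rw [hermitianPart_apply, h.eq]; module

/-- The affine retraction of all matrices onto the Hermitian matrices of trace one. -/
def traceOneRetraction (M : Mat c) : Mat c :=
  projTracelessL c (hermitianPart c M) + (c : ℂ)⁻¹ • (1 : Mat c)

theorem contDiff_traceOneRetraction : ContDiff ℝ ∞ (traceOneRetraction (c := c)) :=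
  ((projTracelessL c).comp (hermitianPart c)).contDiff.add contDiff_const

theorem traceOneRetraction_eq_self {M : Mat c} (h : M.IsHermitian) (ht : M.trace = 1) :
    traceOneRetraction M = M := by
  rw [traceOneRetraction, hermitianPart_eq_self h, projTracelessL_apply, projTraceless, ht,
    one_div, sub_add_cancel]

theorem traceOneRetraction_isHermitian (hc : c ≠ 0) (M : Mat c) :
    (traceOneRetraction M).IsHermitian := by
  refine (projTraceless_mem hc (isHermitian_hermitianPart M)).1.add ?_
  change conjTranspose _ = _
  rw [conjTranspose_smul, conjTranspose_one, star_inv₀, star_natCast]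

theorem traceOneRetraction_trace (hc : c ≠ 0) (M : Mat c) :
    (traceOneRetraction M).trace = 1 := by
  have hc' : (c : ℂ) ≠ 0 := Nat.cast_ne_zero.2 hc
  rw [traceOneRetraction, trace_add, projTracelessL_apply,
    (projTraceless_mem hc (isHermitian_hermitianPart M)).2]
  simp [trace_smul, hc']

/-- The retraction already produces Hermitian matrices of trace one, so only the open condition of
positivity remains. -/
theorem isOpen_preimage_traceOneRetraction (hc : c ≠ 0) :
    IsOpen (traceOneRetraction ⁻¹' densityMatrices c) := by
  have h : traceOneRetraction ⁻¹' densityMatrices c =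
      traceOneRetraction ⁻¹' strictlyAccretive c := by
    ext M
    exact ⟨fun h => densityMatrices_subset h, fun h =>
      ⟨posDef_of_mem_strictlyAccretive h (traceOneRetraction_isHermitian hc M),
        traceOneRetraction_trace hc M⟩⟩
  rw [h]
  exact isOpen_strictlyAccretive.preimage contDiff_traceOneRetraction.continuous

section LineDeriv

variable {F : Type} [NormedAddCommGroup F] [NormedSpace ℝ F] {f : Mat c → F}

/-- Smoothness on density matrices says nothing in directions leaving the trace-one Hermitian
matrices. Composing with the retraction gives an extension to an open set, where `fderiv` is
meaningful. -/
theorem contDiffOn_comp_retraction (hf : ContDiffOn ℝ ∞ f (densityMatrices c)) :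
    ContDiffOn ℝ ∞ (f ∘ traceOneRetraction) (traceOneRetraction ⁻¹' densityMatrices c) :=
  hf.comp contDiff_traceOneRetraction.contDiffOn fun _ h => h

theorem mem_preimage_retraction {ρ : Mat c} (hρ : ρ ∈ densityMatrices c) :
    ρ ∈ traceOneRetraction ⁻¹' densityMatrices c := by
  rw [mem_preimage, traceOneRetraction_eq_self hρ.1.isHermitian hρ.2]
  exact hρ

theorem hasFDerivAt_comp_retraction (hf : ContDiffOn ℝ ∞ f (densityMatrices c)) {ρ : Mat c}
    (hρ : ρ ∈ densityMatrices c) : HasFDerivAt (f ∘ traceOneRetraction)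
      (fderiv ℝ (f ∘ traceOneRetraction) ρ) ρ :=
  (((contDiffOn_comp_retraction hf).differentiableOn (by simp)).differentiableAt
    ((isOpen_preimage_traceOneRetraction (ne_zero_of_mem_densityMatrices hρ)).mem_nhds
      (mem_preimage_retraction hρ))).hasFDerivAt

theorem hasLineDerivAt_retraction (hf : ContDiffOn ℝ ∞ f (densityMatrices c)) {ρ X : Mat c}
    (hρ : ρ ∈ densityMatrices c) (hX : X ∈ tracelessHermitian c) :
    HasLineDerivAt ℝ f (fderiv ℝ (f ∘ traceOneRetraction) ρ X) ρ X := by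
  have h1 : HasLineDerivAt ℝ (f ∘ traceOneRetraction)
      (fderiv ℝ (f ∘ traceOneRetraction) ρ X) ρ X :=
    (hasFDerivAt_comp_retraction hf hρ).hasLineDerivAt X
  refine HasDerivAt.congr_of_eventuallyEq h1 (Eventually.of_forall fun t => ?_)
  -- The retraction fixes the whole line, so f and its extension agree for every t.
  simp only [Function.comp_apply]
  rw [traceOneRetraction_eq_self]
  · exact hρ.1.isHermitian.add ((tracelessHermitian c).smul_mem t hX).1
  · rw [trace_add, hρ.2, ((tracelessHermitian c).smul_mem t hX).2, add_zero]

theorem lineDeriv_eq_retraction (hf : ContDiffOn ℝ ∞ f (densityMatrices c)) {ρ X : Mat c}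
    (hρ : ρ ∈ densityMatrices c) (hX : X ∈ tracelessHermitian c) :
    lineDeriv ℝ f ρ X = fderiv ℝ (f ∘ traceOneRetraction) ρ X :=
  (hasLineDerivAt_retraction hf hρ hX).lineDeriv

theorem hasLineDerivAt_lineDeriv (hf : ContDiffOn ℝ ∞ f (densityMatrices c)) {ρ X : Mat c}
    (hρ : ρ ∈ densityMatrices c) (hX : X ∈ tracelessHermitian c) :
    HasLineDerivAt ℝ f (lineDeriv ℝ f ρ X) ρ X := by
  rw [lineDeriv_eq_retraction hf hρ hX]
  exact hasLineDerivAt_retraction hf hρ hX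

theorem lineDeriv_add_direction (hf : ContDiffOn ℝ ∞ f (densityMatrices c)) {ρ X X' : Mat c}
    (hρ : ρ ∈ densityMatrices c) (hX : X ∈ tracelessHermitian c)
    (hX' : X' ∈ tracelessHermitian c) :
    lineDeriv ℝ f ρ (X + X') = lineDeriv ℝ f ρ X + lineDeriv ℝ f ρ X' := by
  rw [lineDeriv_eq_retraction hf hρ hX, lineDeriv_eq_retraction hf hρ hX',
    lineDeriv_eq_retraction hf hρ ((tracelessHermitian c).add_mem hX hX'), map_add]

theorem contDiffOn_lineDeriv (hf : ContDiffOn ℝ ∞ f (densityMatrices c)) {X : Mat c → Mat c}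
    (hX : IsVectorField X) :
    ContDiffOn ℝ ∞ (fun ρ => lineDeriv ℝ f ρ (X ρ)) (densityMatrices c) := by
  rcases eq_or_ne c 0 with rfl | hc
  · exact fun ρ hρ => absurd rfl (ne_zero_of_mem_densityMatrices hρ)
  · have h1 := (contDiffOn_comp_retraction hf).fderiv_of_isOpen
      (isOpen_preimage_traceOneRetraction hc) (m := ∞) (by simp)
    have h2 := (h1.mono fun ρ hρ => mem_preimage_retraction hρ).clm_apply hX.1
    exact h2.congr fun ρ hρ => lineDeriv_eq_retraction hf hρ (hX.2 ρ hρ)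

end LineDeriv

theorem lineDeriv_mem {Y : Mat c → Mat c} (hY : IsVectorField Y) {ρ X : Mat c}
    (hρ : ρ ∈ densityMatrices c) (hX : X ∈ tracelessHermitian c) :
    lineDeriv ℝ Y ρ X ∈ tracelessHermitian c := by
  have hev := eventually_add_smul_mem_densityMatrices hρ hX
  have h : HasDerivAt (fun t : ℝ => Y (ρ + t • X)) (lineDeriv ℝ Y ρ X) 0 :=
    hasLineDerivAt_lineDeriv hY.1 hρ hX
  refine mem_tracelessHermitian_of_hasDerivWithinAt (uniqueDiffWithinAt_of_mem_nhds hev)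
    h.hasDerivWithinAt fun s hs => ?_
  exact (tracelessHermitian c).sub_mem (hY.2 _ hs) (by simpa using hY.2 ρ hρ)

theorem isVectorField_mConnection {X Y : Mat c → Mat c} (hX : IsVectorField X)
    (hY : IsVectorField Y) : IsVectorField (mConnection X Y) :=
  ⟨contDiffOn_lineDeriv hY.1 hX, fun ρ hρ => lineDeriv_mem hY hρ (hX.2 ρ hρ)⟩

/-! ### The e-connection: existence and uniqueness. -/

/-- A vector field read in the exponential chart. -/
def pushChart (Y : Mat c → Mat c) (σ : Mat c) : Mat c := fderiv ℝ eChart σ (Y σ)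

theorem contDiffOn_fderiv_eChart :
    ContDiffOn ℝ ∞ (fderiv ℝ (eChart (c := c))) (strictlyAccretive c) :=
  contDiffOn_eChart.fderiv_of_isOpen isOpen_strictlyAccretive (by simp)

theorem isVectorField_pushChart {Y : Mat c → Mat c} (hY : IsVectorField Y) :
    IsVectorField (pushChart Y) :=
  ⟨(contDiffOn_fderiv_eChart.mono densityMatrices_subset).clm_apply hY.1,
    fun ρ hρ => fderiv_eChart_mem hρ (hY.2 ρ hρ)⟩

/-- The pullback of the flat connection by the exponential chart. -/
def chartConnection (X Y : Mat c → Mat c) (ρ : Mat c) : Mat c :=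
  fderiv ℝ Gam (eChart ρ) (mConnection X (pushChart Y) ρ)

theorem isVectorField_chartConnection {X Y : Mat c → Mat c} (hX : IsVectorField X)
    (hY : IsVectorField Y) : IsVectorField (chartConnection X Y) := by
  have hm := isVectorField_mConnection hX (isVectorField_pushChart hY)
  refine ⟨?_, fun ρ hρ => fderiv_Gam_mem (ne_zero_of_mem_densityMatrices hρ) (eChart_mem hρ)
    (hm.2 ρ hρ)⟩
  have h1 : ContDiffOn ℝ ∞ (fderiv ℝ (Gam (c := c))) (gamDomain c) :=
    contDiffOn_Gam.fderiv_of_isOpen isOpen_gamDomain (by simp)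
  have h2 : ContDiffOn ℝ ∞ (fun ρ : Mat c => fderiv ℝ Gam (eChart ρ)) (densityMatrices c) :=
    h1.comp (contDiffOn_eChart.mono densityMatrices_subset) fun ρ hρ =>
      mem_gamDomain (ne_zero_of_mem_densityMatrices hρ) (eChart_mem hρ).1
  exact h2.clm_apply hm.1

theorem isVectorField_const {X : Mat c} (hX : X ∈ tracelessHermitian c) :
    IsVectorField (fun _ : Mat c => X) := ⟨contDiffOn_const, fun _ _ => hX⟩

theorem IsVectorField.add {Y Y' : Mat c → Mat c} (hY : IsVectorField Y) (hY' : IsVectorField Y') :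
    IsVectorField (fun σ => Y σ + Y' σ) :=
  ⟨hY.1.add hY'.1, fun ρ hρ => (tracelessHermitian c).add_mem (hY.2 ρ hρ) (hY'.2 ρ hρ)⟩

theorem fderiv_eChart_chartConnection {X Y : Mat c → Mat c} (hX : IsVectorField X)
    (hY : IsVectorField Y) {ρ : Mat c} (hρ : ρ ∈ densityMatrices c) :
    fderiv ℝ eChart ρ (chartConnection X Y ρ) = mConnection X (pushChart Y) ρ := by
  have h := fderiv_eChart_fderiv_Gam (ne_zero_of_mem_densityMatrices hρ) (eChart_mem hρ)
    ((isVectorField_mConnection hX (isVectorField_pushChart hY)).2 ρ hρ)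
  rwa [Gam_eChart hρ] at h

theorem pushChart_add (Y Y' : Mat c → Mat c) :
    pushChart (fun σ => Y σ + Y' σ) = fun σ => pushChart Y σ + pushChart Y' σ := by
  ext1 σ; simp [pushChart]

theorem pushChart_smul (f : Mat c → ℝ) (Y : Mat c → Mat c) :
    pushChart (fun σ => f σ • Y σ) = fun σ => f σ • pushChart Y σ := by
  ext1 σ; simp [pushChart]

theorem isAffineConnection_chartConnection :
    IsAffineConnection (chartConnection (c := c)) where
  isVectorField := isVectorField_chartConnection
  add_left := fun {X X' Y} hX hX' hY ρ hρ => by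
    simp only [chartConnection, mConnection]
    rw [lineDeriv_add_direction (isVectorField_pushChart hY).1 hρ (hX.2 ρ hρ) (hX'.2 ρ hρ), map_add]
  smul_left := fun {X Y f} hX hY hf ρ hρ => by
    simp only [chartConnection, mConnection]
    rw [lineDeriv_smul, map_smul]
  add_right := fun {X Y Y'} hX hY hY' ρ hρ => by
    have h1 := hasLineDerivAt_lineDeriv (isVectorField_pushChart hY).1 hρ (hX.2 ρ hρ)
    have h2 := hasLineDerivAt_lineDeriv (isVectorField_pushChart hY').1 hρ (hX.2 ρ hρ)
    have h3 : HasLineDerivAt ℝ (fun σ => pushChart Y σ + pushChart Y' σ) _ ρ (X ρ) := h1.add h2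
    simp only [chartConnection, mConnection]
    rw [pushChart_add, h3.lineDeriv, map_add]
  leibniz := fun {X Y f} hX hY hf ρ hρ => by
    have h1 : HasDerivAt (fun t : ℝ => f (ρ + t • X ρ)) (lineDeriv ℝ f ρ (X ρ)) 0 :=
      hasLineDerivAt_lineDeriv hf hρ (hX.2 ρ hρ)
    have h2 : HasDerivAt (fun t : ℝ => pushChart Y (ρ + t • X ρ))
        (lineDeriv ℝ (pushChart Y) ρ (X ρ)) 0 :=
      hasLineDerivAt_lineDeriv (isVectorField_pushChart hY).1 hρ (hX.2 ρ hρ)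
    have h3 : HasLineDerivAt ℝ (fun σ => f σ • pushChart Y σ) _ ρ (X ρ) := h1.smul h2
    simp only [chartConnection, mConnection]
    rw [pushChart_smul, h3.lineDeriv, zero_smul, add_zero, map_add, map_smul, map_smul, pushChart,
      fderiv_Gam_fderiv_eChart hρ (hY.2 ρ hρ)]

/-- Near ρ along X the metric equals Re tr(Z · dθ(Y)), so duality is the product rule for this
trace. -/
theorem areDual_chartConnection : AreDual (chartConnection (c := c)) mConnection := by
  intro X Y Z hX hY hZ ρ hρ
  have hXρ := hX.2 ρ hρ
  have h1 : HasDerivAt (fun t : ℝ => pushChart Y (ρ + t • X ρ))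
      (lineDeriv ℝ (pushChart Y) ρ (X ρ)) 0 :=
    hasLineDerivAt_lineDeriv (isVectorField_pushChart hY).1 hρ hXρ
  have h2 : HasDerivAt (fun t : ℝ => Z (ρ + t • X ρ)) (lineDeriv ℝ Z ρ (X ρ)) 0 :=
    hasLineDerivAt_lineDeriv hZ.1 hρ hXρ
  have h3 := ((LinearMap.toContinuousLinearMap (traceLinearMap (Fin c) ℝ ℂ)).hasFDerivAt
    (x := Z (ρ + (0 : ℝ) • X ρ) * pushChart Y (ρ + (0 : ℝ) • X ρ))).comp_hasDerivAt (0 : ℝ)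
      (h2.mul h1)
  have h4 := (Complex.reCLM.hasFDerivAt).comp_hasDerivAt (0 : ℝ) h3
  have h5 : HasLineDerivAt ℝ (fun σ => bkm σ (Y σ) (Z σ)) _ ρ (X ρ) :=
    HasDerivAt.congr_of_eventuallyEq h4 <| by
      filter_upwards [eventually_add_smul_mem_densityMatrices hρ hXρ] with t ht
      rw [bkm_eq_tracePairing_eChart (densityMatrices_subset ht) _ (hZ.2 _ ht)]
      rfl
  have hU := densityMatrices_subset hρ
  rw [h5.lineDeriv, bkm_eq_tracePairing_eChart hU _ (hZ.2 ρ hρ),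
    fderiv_eChart_chartConnection hX hY hρ,
    bkm_eq_tracePairing_eChart hU _ ((isVectorField_mConnection hX hZ).2 ρ hρ)]
  rw [zero_smul, add_zero, map_add, map_add, add_comm]
  rfl

theorem isEConnection_chartConnection : IsEConnection (chartConnection (c := c)) :=
  ⟨isAffineConnection_chartConnection, areDual_chartConnection⟩

/-- Duality determines g(∇_X Y, Z) for every Z. Testing the difference A of two candidates against
the constant field Z = dθ(A) gives Re tr(Z²) = 0, hence dθ(A) = 0 and A = 0. -/
theorem IsEConnection.eqOn {nab nab' : (Mat c → Mat c) → (Mat c → Mat c) → Mat c → Mat c}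
    (h : IsEConnection nab) (h' : IsEConnection nab') {X Y : Mat c → Mat c}
    (hX : IsVectorField X) (hY : IsVectorField Y) :
    EqOn (nab X Y) (nab' X Y) (densityMatrices c) := by
  intro ρ hρ
  have hU := densityMatrices_subset hρ
  set A := nab X Y ρ - nab' X Y ρ with hA
  have hAmem : A ∈ tracelessHermitian c := (tracelessHermitian c).sub_mem
    ((h.isAffineConnection.isVectorField hX hY).2 ρ hρ)
    ((h'.isAffineConnection.isVectorField hX hY).2 ρ hρ)
  have hGA := fderiv_eChart_mem hρ hAmem
  have hZ := isVectorField_const hGA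
  have h1 := h.dual hX hY hZ ρ hρ
  rw [h'.dual hX hY hZ ρ hρ, add_left_inj, bkm_eq_tracePairing_eChart hU _ hGA,
    bkm_eq_tracePairing_eChart hU _ hGA] at h1
  have h2 : tracePairing (fderiv ℝ eChart ρ A) (fderiv ℝ eChart ρ A) = 0 := by
    conv_lhs => enter [2]; rw [hA, map_sub]
    rw [map_sub, h1, sub_self]
  have h3 := fderiv_Gam_fderiv_eChart hρ hAmem
  rw [eq_zero_of_tracePairing hGA h2, map_zero] at h3
  exact sub_eq_zero.1 h3.symm

end

end QuantumStates

/-! ### Geodesics and the exponential map. -/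

section

variable {E G : Type} [NormedAddCommGroup E] [NormedSpace ℝ E] [NormedAddCommGroup G]
  [NormedSpace ℝ G]

/-- Product rule for the differential of a smooth map along a curve. -/
theorem ContDiffOn.hasDerivWithinAt_fderiv_apply {f : E → G} {U : Set E} (hf : ContDiffOn ℝ ∞ f U)
    (hU : IsOpen U) {γ v : ℝ → E} {u a : E} {J : Set ℝ} {t : ℝ} (hmem : γ t ∈ U)
    (hγ : HasDerivWithinAt γ u J t) (hv : HasDerivWithinAt v a J t) :
    HasDerivWithinAt (fun s => fderiv ℝ f (γ s) (v s))
      (lineDeriv ℝ (fun x => fderiv ℝ f x (v t)) (γ t) u + fderiv ℝ f (γ t) a) J t := by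
  have h1 : HasFDerivAt (fderiv ℝ f) (fderiv ℝ (fderiv ℝ f) (γ t)) (γ t) :=
    (((hf.fderiv_of_isOpen hU (m := ∞) (by simp)).differentiableOn (by simp)).differentiableAt
      (hU.mem_nhds hmem)).hasFDerivAt
  have h2 : HasDerivAt (fun s : ℝ => fderiv ℝ f (γ t + s • u))
      (fderiv ℝ (fderiv ℝ f) (γ t) u) 0 := h1.hasLineDerivAt u
  have h3 : HasLineDerivAt ℝ (fun x => fderiv ℝ f x (v t)) _ (γ t) u :=
    h2.clm_apply (hasDerivAt_const (0 : ℝ) (v t))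
  rw [h3.lineDeriv, map_zero, add_zero]
  exact (h1.comp_hasDerivWithinAt t hγ).clm_apply hv

end

namespace QuantumStates

open Set Filter Topology Matrix

variable {c : ℕ}

noncomputable section

/-- The Christoffel term of an e-connection in the frame of constant vector fields. -/
theorem IsEConnection.apply_const
    {nab : (Mat c → Mat c) → (Mat c → Mat c) → Mat c → Mat c} (h : IsEConnection nab)
    {ρ v : Mat c} (hρ : ρ ∈ densityMatrices c) (hv : v ∈ tracelessHermitian c) :
    nab (fun _ => v) (fun _ => v) ρ =
      fderiv ℝ Gam (eChart ρ) (mConnection (fun _ => v) (pushChart fun _ => v) ρ) := by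
  rw [h.eqOn isEConnection_chartConnection (isVectorField_const hv) (isVectorField_const hv) hρ,
    chartConnection]

theorem mConnection_pushChart_const_mem {ρ v : Mat c} (hρ : ρ ∈ densityMatrices c)
    (hv : v ∈ tracelessHermitian c) :
    mConnection (fun _ => v) (pushChart fun _ => v) ρ ∈ tracelessHermitian c :=
  (isVectorField_mConnection (isVectorField_const hv)
    (isVectorField_pushChart (isVectorField_const hv))).2 ρ hρ

theorem hasDerivWithinAt_fderiv_eChart {γ v : ℝ → Mat c} {a : Mat c} {J : Set ℝ} {t : ℝ}
    (hmem : γ t ∈ densityMatrices c) (hγ : HasDerivWithinAt γ (v t) J t)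
    (hv : HasDerivWithinAt v a J t) :
    HasDerivWithinAt (fun s => fderiv ℝ eChart (γ s) (v s))
      (mConnection (fun _ => v t) (pushChart fun _ => v t) (γ t) + fderiv ℝ eChart (γ t) a) J t :=
  contDiffOn_eChart.hasDerivWithinAt_fderiv_apply isOpen_strictlyAccretive
    (densityMatrices_subset hmem) hγ hv

/-- A geodesic of the e-connection is a straight line in the exponential chart. -/
theorem IsGeodesicFrom.eq_Gam
    {nab : (Mat c → Mat c) → (Mat c → Mat c) → Mat c → Mat c} (h : IsEConnection nab)
    {J : Set ℝ} (hJ : J.OrdConnected) (h0 : (0 : ℝ) ∈ J) {ρ X : Mat c} {μ : ℝ → Mat c}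
    (hμ : IsGeodesicFrom nab J ρ X μ) {t : ℝ} (ht : t ∈ J) :
    μ t = Gam (eChart ρ + t • fderiv ℝ eChart ρ X) := by
  obtain ⟨v, hμ0, hv0, hgeo⟩ := hμ
  have hρ : ρ ∈ densityMatrices c := hμ0 ▸ (hgeo 0 h0).1
  -- On a one-point J derivatives are not unique, but the only time is 0.
  rcases J.subsingleton_or_nontrivial with hs | hn
  · rw [hs ht h0, zero_smul, add_zero, Gam_eChart hρ, hμ0]
  have hconv : Convex ℝ J := hJ.convex
  have huniq : UniqueDiffOn ℝ J :=
    uniqueDiffOn_convex hconv (hconv.nontrivial_iff_nonempty_interior.1 hn)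
  have hvmem : ∀ s ∈ J, v s ∈ tracelessHermitian c := fun s hs =>
    mem_tracelessHermitian_of_hasDerivWithinAt (huniq s hs) (hgeo s hs).2.1 fun r hr =>
      sub_mem_tracelessHermitian (hgeo r hr).1 (hgeo s hs).1
  -- The velocity read in the chart. The geodesic equation says exactly that its derivative
  -- vanishes.
  set w : ℝ → Mat c := fun s => fderiv ℝ eChart (μ s) (v s) with hw
  have hw' : ∀ s ∈ J, HasDerivWithinAt w 0 J s := by
    intro s hs
    have hm := (hgeo s hs).1
    have h1 := hasDerivWithinAt_fderiv_eChart hm (hgeo s hs).2.1 (hgeo s hs).2.2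
    refine h1.congr_deriv ?_
    have h2 := fderiv_eChart_fderiv_Gam (ne_zero_of_mem_densityMatrices hm) (eChart_mem hm)
      (mConnection_pushChart_const_mem hm (hvmem s hs))
    rw [Gam_eChart hm] at h2
    rw [h.apply_const hm (hvmem s hs), map_neg, h2, add_neg_cancel]
  have hwconst : ∀ s ∈ J, w s = fderiv ℝ eChart ρ X := by
    intro s hs
    have h1 := hconv.norm_image_sub_le_of_norm_hasDerivWithin_le (C := 0) hw' (by simp) h0 hs
    rw [zero_mul, norm_le_zero_iff, sub_eq_zero] at h1
    rw [h1, hw]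
    simp only [hμ0, hv0]
  -- The deviation from the straight line in the chart. Its derivative vanishes because w is
  -- constant.
  set u : ℝ → Mat c := fun s => eChart (μ s) - s • fderiv ℝ eChart ρ X with hu
  have hu' : ∀ s ∈ J, HasDerivWithinAt u 0 J s := by
    intro s hs
    have h1 : HasDerivWithinAt (fun r => eChart (μ r)) (w s) J s :=
      (hasFDerivAt_eChart (hgeo s hs).1).comp_hasDerivWithinAt s (hgeo s hs).2.1
    have h2 : HasDerivWithinAt (fun r : ℝ => r • fderiv ℝ eChart ρ X)
        ((1 : ℝ) • fderiv ℝ eChart ρ X) J s :=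
      (hasDerivWithinAt_id s J).smul_const _
    refine (h1.sub h2).congr_deriv ?_
    rw [hwconst s hs, one_smul, sub_self]
  have h1 := hconv.norm_image_sub_le_of_norm_hasDerivWithin_le (C := 0) hu' (by simp) h0 ht
  rw [zero_mul, norm_le_zero_iff, sub_eq_zero] at h1
  simp only [hu, hμ0, zero_smul, sub_zero] at h1
  rw [← h1, sub_add_cancel, Gam_eChart (hgeo t ht).1]

/-- Straight lines in the exponential chart are geodesics of the e-connection. -/
theorem isGeodesicFrom_Gam
    {nab : (Mat c → Mat c) → (Mat c → Mat c) → Mat c → Mat c} (h : IsEConnection nab)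
    {ρ X : Mat c} (hρ : ρ ∈ densityMatrices c) (hX : X ∈ tracelessHermitian c) (J : Set ℝ) :
    IsGeodesicFrom nab J ρ X (fun t : ℝ => Gam (eChart ρ + t • fderiv ℝ eChart ρ X)) := by
  have hc := ne_zero_of_mem_densityMatrices hρ
  set A := fderiv ℝ eChart ρ X with hA
  have hAmem : A ∈ tracelessHermitian c := fderiv_eChart_mem hρ hX
  have hline : ∀ t : ℝ, eChart ρ + t • A ∈ tracelessHermitian c := fun t =>
    (tracelessHermitian c).add_mem (eChart_mem hρ) ((tracelessHermitian c).smul_mem t hAmem)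
  set γ : ℝ → Mat c := fun t => Gam (eChart ρ + t • A) with hγ
  set v : ℝ → Mat c := fun t => fderiv ℝ Gam (eChart ρ + t • A) A with hv
  have hγmem : ∀ t, γ t ∈ densityMatrices c := fun t => Gam_mem hc (hline t).1
  have hγ' : ∀ t, HasDerivAt γ (v t) t := fun t =>
    hasDerivAt_Gam_line hc (eChart_mem hρ) hAmem t
  have hvmem : ∀ t, v t ∈ tracelessHermitian c := fun t => fderiv_Gam_mem hc (hline t) hAmem
  refine ⟨v, ?_, ?_, fun t _ => ⟨hγmem t, (hγ' t).hasDerivWithinAt, ?_⟩⟩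
  · change Gam (eChart ρ + (0 : ℝ) • A) = ρ
    rw [zero_smul, add_zero, Gam_eChart hρ]
  · change fderiv ℝ Gam (eChart ρ + (0 : ℝ) • A) A = X
    rw [zero_smul, add_zero, hA, fderiv_Gam_fderiv_eChart hρ hX]
  · obtain ⟨a, ha⟩ : ∃ a, HasDerivAt v a t := by
      have h1 : HasDerivAt (fun s : ℝ => eChart ρ + s • A) A t := by
        simpa using ((hasDerivAt_id t).smul_const A).const_add (eChart ρ)
      exact ⟨_, (contDiffOn_Gam.hasDerivWithinAt_fderiv_apply isOpen_gamDomain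
        (mem_gamDomain hc (hline t).1) h1.hasDerivWithinAt
        (hasDerivWithinAt_const t univ A)).hasDerivAt univ_mem⟩
    have hamem : a ∈ tracelessHermitian c :=
      mem_tracelessHermitian_of_hasDerivWithinAt uniqueDiffWithinAt_univ ha.hasDerivWithinAt
        fun s _ => (tracelessHermitian c).sub_mem (hvmem s) (hvmem t)
    have h1 : HasDerivWithinAt (fun s => fderiv ℝ eChart (γ s) (v s)) _ univ t :=
      hasDerivWithinAt_fderiv_eChart (hγmem t) (hγ' t).hasDerivWithinAt ha.hasDerivWithinAt
    -- The chart velocity is the constant A, so the Christoffel term plus dθ(a) is zero. Applying dΓ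
    -- then recovers the acceleration a as required.
    have h2 : (fun s => fderiv ℝ eChart (γ s) (v s)) = fun _ => A :=
      funext fun s => fderiv_eChart_fderiv_Gam hc (hline s) hAmem
    rw [h2] at h1
    have h3 := uniqueDiffWithinAt_univ.eq_deriv _ h1 (hasDerivWithinAt_const t univ A)
    have h4 := fderiv_Gam_fderiv_eChart (hγmem t) hamem
    rw [eq_neg_of_add_eq_zero_right h3, map_neg, ← h.apply_const (hγmem t) (hvmem t)] at h4
    rw [h4]
    exact ha.hasDerivWithinAt

/-- The definition chooses an arbitrary geodesic on [0, 1]. Uniqueness makes its endpoint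
independent of the choice. -/
theorem expMap_eq {nab : (Mat c → Mat c) → (Mat c → Mat c) → Mat c → Mat c}
    (h : IsEConnection nab) {ρ X : Mat c} (hρ : ρ ∈ densityMatrices c)
    (hX : X ∈ tracelessHermitian c) :
    expMap nab ρ X = Gam (eChart ρ + fderiv ℝ eChart ρ X) := by
  have hex : ∃ γ : ℝ → Mat c, IsGeodesicFrom nab (Icc 0 1) ρ X γ :=
    ⟨_, isGeodesicFrom_Gam h hρ hX _⟩
  rw [expMap, dif_pos hex,
    IsGeodesicFrom.eq_Gam h ordConnected_Icc (by simp) hex.choose_spec (t := 1) (by simp),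
    one_smul]

end

end QuantumStates

theorem proposition4p4 (c : ℕ) :
    -- the e-connection exists
    (∃ nab : (Mat c → Mat c) → (Mat c → Mat c) → Mat c → Mat c, IsEConnection nab) ∧
    -- the e-connection is unique
    (∀ nab nab' : (Mat c → Mat c) → (Mat c → Mat c) → Mat c → Mat c,
      IsEConnection nab → IsEConnection nab' →
      ∀ X Y : Mat c → Mat c, IsVectorField X → IsVectorField Y →
        Set.EqOn (nab X Y) (nab' X Y) (densityMatrices c)) ∧
    -- its geodesics and its exponential map
    ∀ nab : (Mat c → Mat c) → (Mat c → Mat c) → Mat c → Mat c, IsEConnection nab →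
      ∀ ρ ∈ densityMatrices c, ∀ X ∈ tracelessHermitian c,
        IsGeodesicFrom nab Set.univ ρ X
          (fun t : ℝ => Gam (GamInv ρ + t • projTraceless (opT ρ X))) ∧
        (∀ (J : Set ℝ) (μ : ℝ → Mat c), J.OrdConnected → 0 ∈ J →
          IsGeodesicFrom nab J ρ X μ →
          ∀ t ∈ J, μ t = Gam (GamInv ρ + t • projTraceless (opT ρ X))) ∧
        (∀ t : ℝ, expMap nab ρ (t • X) =
          Gam (GamInv ρ + t • projTraceless (opT ρ X))) ∧
        expMap nab ρ X = Gam (GamInv ρ + dGamInv ρ X) ∧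
        expMap nab ρ X = Gam (GamInv ρ + projTraceless (opT ρ X)) := by
  refine ⟨⟨chartConnection, isEConnection_chartConnection⟩,
    fun nab nab' h h' X Y hX hY => h.eqOn h' hX hY, fun nab h ρ hρ X hX => ?_⟩
  rw [projTraceless_opT hρ hX, GamInv_eq_eChart hρ, dGamInv_eq hρ hX]
  refine ⟨isGeodesicFrom_Gam h hρ hX _, fun J μ hJ h0 hμ t ht => hμ.eq_Gam h hJ h0 ht,
    fun t => ?_, expMap_eq h hρ hX, expMap_eq h hρ hX⟩
  rw [expMap_eq h hρ ((tracelessHermitian c).smul_mem t hX), map_smul]
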